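/- **Conventions.** An additive category is *preabelian* if every morphism has a kernel and a cokernel. It is *quasi-abelian* if it is preabelian, every pullback of a cokernel is a cokernel, and every pushout of a kernel is a kernel. An additive category is *Krull–Schmidt* if every object is a finite (possibly empty) direct sum of objects with local endomorphism ring. A *section* is a split monomorphism and a *retraction* is a split epimorphism. A sequence $\xi\colon X\overset{f}{\to}Y\overset{g}{\to}Z$ is *short exact* if $f$ is a kernel of $g$ and $g$ is a cokernel of $f$. For $a\colon X\to X'$, the sequence $a\xi\colon X'\overset{f'}{\to}X'\amalg_X Y\overset{g'}{\to}Z$ consists of the pushout $f'$ of $f$ along $a$ and the morphism $g'$ induced by $0\colon X'\to Z$ and $g$. For $b\colon Z'\to Z$, the sequence $\xi b\colon X\overset{f'}{\to}Y\times_Z Z'\overset{g'}{\to}Z'$ consists of the pullback $g'$ of $g$ along $b$ and the morphism $f'$ induced by $f$ and $0\colon X\to Z'$. In a preabelian category, the short exact sequence $\xi$ is *stable exact* if $a\xi$ and $\xi b$ are short exact for all $X'$, $Z'$, $a\colon X\to X'$ and $b\colon Z'\to Z$. A morphism $f\colon X\to Y$ is *right almost split* if it is not a retraction and every non-retraction $u\colon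 U\to Y$ factors as $u=f\hat u$ for some $\hat u\colon U\to X$; it is *right minimal* if every $e\colon X\to X$ with $fe=f$ is an automorphism; and it is *minimal right almost split* if it is both. *Left almost split*, *left minimal* and *minimal left almost split* are defined dually. A morphism $f$ is *irreducible* if it is neither a section nor a retraction, and whenever $f=hg$, either $h$ is a retraction or $g$ is a section. A sequence $X\overset{f}{\to}Y\overset{g}{\to}Z$ is an *Auslander–Reiten sequence* if $gf=0$, every $h\colon V\to Y$ with $gh=0$ factors through $f$, every $h\colon Y\to V$ with $hf=0$ factors through $g$ (factorisations not required to be unique), $f$ is minimal left almost split, and $g$ is minimal right almost split. **Theorem.** Let $\mathcal A$ be a skeletally small preabelian category and let $\xi\colon X\overset{f}{\to}Y\overset{g}{\to}Z$ be a stable exact sequence in $\mathcal A$. Then the following statements are equivalent: (i) $\xi$ is an Auslander–Reiten sequence; (ii) $\operatorname{End}_{\mathcal A}X$ is a local ring and $g$ is right almost split; (iii) $\operatorname{End}_{\mathcal A}Z$ is a local ring and $f$ is left almost split. If, moreover, $\mathcal A$ is quasi-abelian and Krull–Schmidt, then (i)–(iii) are also equivalent to each of the following: (iv) $f$ is minimal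 left almost split; (v) $g$ is minimal right almost split; (vi) $f$ and $g$ are both irreducible. -/

import Mathlib

open CategoryTheory CategoryTheory.Limits

universe v u

namespace AuslanderReiten

section Category

variable {C : Type u} [Category.{v} C]

/-- A morphism is irreducible if it is neither a section nor a retraction, and in every
factorisation of it the first factor is a section or the second factor is a retraction. -/
structure IsIrreducibleMor {X Y : C} (f : X ⟶ Y) : Prop where
  not_section : ¬ IsSplitMono f
  not_retraction : ¬ IsSplitEpi f
  factor : ∀ {W : C} (p : X ⟶ W) (q : W ⟶ Y), p ≫ q = f → IsSplitEpi q ∨ IsSplitMono p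

/-- `f` is not a retraction, and every non-retraction with the same target factors through `f`. -/
structure IsRightAlmostSplit {X Y : C} (f : X ⟶ Y) : Prop where
  not_retraction : ¬ IsSplitEpi f
  factor : ∀ {U : C} (h : U ⟶ Y), ¬ IsSplitEpi h → ∃ k : U ⟶ X, k ≫ f = h

/-- `f` is not a section, and every non-section with the same source factors through `f`. -/
structure IsLeftAlmostSplit {X Y : C} (f : X ⟶ Y) : Prop where
  not_section : ¬ IsSplitMono f
  factor : ∀ {U : C} (h : X ⟶ U), ¬ IsSplitMono h → ∃ k : Y ⟶ U, f ≫ k = h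

/-- Every endomorphism `e` of the source with `f ∘ e = f` is an automorphism. -/
def IsRightMinimal {X Y : C} (f : X ⟶ Y) : Prop :=
  ∀ e : X ⟶ X, e ≫ f = f → IsIso e

/-- Every endomorphism `e` of the target with `e ∘ f = f` is an automorphism. -/
def IsLeftMinimal {X Y : C} (f : X ⟶ Y) : Prop :=
  ∀ e : Y ⟶ Y, f ≫ e = f → IsIso e

/-- Minimal right almost split morphisms. -/
structure IsMinRightAlmostSplit {X Y : C} (f : X ⟶ Y) : Prop where
  minimal : IsRightMinimal f
  almostSplit : IsRightAlmostSplit f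

/-- Minimal left almost split morphisms. -/
structure IsMinLeftAlmostSplit {X Y : C} (f : X ⟶ Y) : Prop where
  minimal : IsLeftMinimal f
  almostSplit : IsLeftAlmostSplit f

end Category

section Preadditive

variable {C : Type u} [Category.{v} C] [Preadditive C]

/-- `X ⟶ Y ⟶ Z` is short exact: `f` is a kernel of `g` and `g` is a cokernel of `f`. -/
structure IsShortExact {X Y Z : C} (f : X ⟶ Y) (g : Y ⟶ Z) : Prop where
  zero : f ≫ g = 0
  isKernel : Nonempty (IsLimit (KernelFork.ofι f zero))
  isCokernel : Nonempty (IsColimit (CokernelCofork.ofπ g zero))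

/-- A short exact sequence `ξ : X ⟶ Y ⟶ Z` is stable if for every `a : X ⟶ X'` and every
`b : Z' ⟶ Z` the sequences `aξ` and `ξb` are short exact. Here `aξ : X' ⟶ Y' ⟶ Z` has as first
morphism `f'` the pushout of `f` along `a`, and as second morphism the one induced by `0` and `g`;
dually `ξb : X ⟶ Y' ⟶ Z'` has as second morphism `g'` the pullback of `g` along `b`, and as
first morphism the one induced by `f` and `0`. (The sequences are determined up to isomorphism, so
we quantify over all choices of the pushout and of the pullback.) -/
structure IsStableExact {X Y Z : C} (f : X ⟶ Y) (g : Y ⟶ Z) : Prop where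
  shortExact : IsShortExact f g
  pushout : ∀ {X' Y' : C} (a : X ⟶ X') (f' : X' ⟶ Y') (a' : Y ⟶ Y') (g' : Y' ⟶ Z),
    IsPushout f a a' f' → f' ≫ g' = 0 → a' ≫ g' = g → IsShortExact f' g'
  pullback : ∀ {Z' Y' : C} (b : Z' ⟶ Z) (g' : Y' ⟶ Z') (b' : Y' ⟶ Y) (f' : X ⟶ Y'),
    IsPullback b' g' g b → f' ≫ g' = 0 → f' ≫ b' = f → IsShortExact f' g'

/-- `f` is a weak kernel of `g`. -/
structure IsWeakKernel {X Y Z : C} (f : X ⟶ Y) (g : Y ⟶ Z) : Prop where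
  zero : f ≫ g = 0
  factor : ∀ {V : C} (h : V ⟶ Y), h ≫ g = 0 → ∃ k : V ⟶ X, k ≫ f = h

/-- `g` is a weak cokernel of `f`. -/
structure IsWeakCokernel {X Y Z : C} (f : X ⟶ Y) (g : Y ⟶ Z) : Prop where
  zero : f ≫ g = 0
  factor : ∀ {V : C} (h : Y ⟶ V), f ≫ h = 0 → ∃ k : Z ⟶ V, g ≫ k = h

/-- Auslander-Reiten sequences: short weak exact sequences `X ⟶ Y ⟶ Z` whose first morphism is
minimal left almost split and whose second morphism is minimal right almost split. -/
structure IsAuslanderReitenSeq {X Y Z : C} (f : X ⟶ Y) (g : Y ⟶ Z) : Prop where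
  weakKernel : IsWeakKernel f g
  weakCokernel : IsWeakCokernel f g
  left : IsMinLeftAlmostSplit f
  right : IsMinRightAlmostSplit g

variable (C)

/-- The class of all morphisms that are a kernel of some morphism. -/
def kernelMorphisms : MorphismProperty C := fun _ _ f => Nonempty (NormalMono f)

/-- The class of all morphisms that are a cokernel of some morphism. -/
def cokernelMorphisms : MorphismProperty C := fun _ _ f => Nonempty (NormalEpi f)

/-- Preabelian categories: additive categories in which every morphism has a kernel and a
cokernel. (Finite biproducts include the empty one, that is, a zero object.) -/
class IsPreabelian : Prop where
  hasFiniteBiproducts : HasFiniteBiproducts C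
  hasKernels : HasKernels C
  hasCokernels : HasCokernels C

attribute [instance] IsPreabelian.hasFiniteBiproducts IsPreabelian.hasKernels
  IsPreabelian.hasCokernels

/-- Quasi-abelian categories: preabelian categories in which cokernels are stable under pullback
and kernels are stable under pushout. -/
structure IsQuasiAbelian : Prop where
  preabelian : IsPreabelian C
  cokernels_pullback : (cokernelMorphisms C).IsStableUnderBaseChange
  kernels_pushout : (kernelMorphisms C).IsStableUnderCobaseChange

/-- Krull-Schmidt categories: additive categories in which every object is a finite direct sum
(possibly empty) of objects with local endomorphism ring. -/
structure IsKrullSchmidt : Prop where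
  hasFiniteBiproducts : HasFiniteBiproducts C
  decomposition : ∀ X : C, ∃ (n : ℕ) (M : Fin n → C),
    (∀ i, IsLocalRing (End (M i))) ∧ Nonempty (X ≅ ⨁ M)

end Preadditive

end AuslanderReiten

/-!
The theorem rests on elementary manipulations of a short exact sequence `ξ : X ⟶ Y ⟶ Z`, with maps
`f` and `g`. Each fact below comes with its dual, proved by reversing the arrows.

* A left almost split morphism has a source with local endomorphism ring, because the
  endomorphisms which are not sections are exactly those factoring through it, and these are closed
  under addition (`IsLeftAlmostSplit.isLocalRing_end`).
* An endomorphism `e` of `Y` with `f ≫ e = f` has the form `1 + g ≫ h`, and it is invertible as soon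
  as `1 + h ≫ g` is. If `End Z` is local and `g` is not a retraction, then `h ≫ g` is not invertible,
  so `1 + h ≫ g` is. Thus `f` is left minimal (`IsShortExact.isLeftMinimal`).
* If `End X` is local and `g` is right almost split, then `f` is left almost split
  (`IsStableExact.isLeftAlmostSplit`). Given `a : X ⟶ X'`, either `aξ` splits, and then `a` factors
  through `f`, or the second map of `aξ` factors through `g`. The latter gives a morphism `aξ ⟶ ξ`
  over `Z`, hence `c : X' ⟶ X` such that `1 - a ≫ c` factors through `f`. As `f` is not a section,
  `1 - a ≫ c` is not invertible, so `a ≫ c` is invertible and `a` is a section.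

These three facts and their duals give the equivalence of the first three conditions. Now let the
category be Krull-Schmidt.

* If `f` is minimal left almost split, then some indecomposable summand `b : Z' ⟶ Z` does not lift
  through `g`. The first map of `ξb` then factors through `f`, and minimality makes
  `Y ×_Z Z' ⟶ Y` a retraction. Hence `b` is an epimorphism, so it is an isomorphism and `End Z` is
  local (`IsMinLeftAlmostSplit.isLocalRing_end_coker`).
* If `f` and `g` are irreducible and `b : U ⟶ Z` is a non-retraction with `End U` local, then `f`
  factors through the first map of `ξb`. Irreducibility of `f` implies that `b` lifts through `g` or
  that `g` factors through `b`. In the second case irreducibility of `g` makes `Y` a nonzero summand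
  of `U`, so `Y ≅ U` and `b` lifts through `g` again. Hence `g` is right almost split
  (`IsStableExact.isRightAlmostSplit_of_irreducible`).

Stability of `ξ` makes all the sequences `aξ` and `ξb` used here short exact, so beyond the
Krull-Schmidt property nothing more is required of the category.
-/

namespace AuslanderReiten

section Category

variable {C : Type u} [Category.{v} C]

/-! ### Minimal almost split morphisms are irreducible -/

theorem IsMinLeftAlmostSplit.isIrreducibleMor {X Y : C} {f : X ⟶ Y} [Mono f]
    (hf : IsMinLeftAlmostSplit f) : IsIrreducibleMor f where
  not_section := hf.almostSplit.not_section
  not_retraction h := hf.almostSplit.not_section (by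
    have := isIso_of_mono_of_isSplitEpi f
    infer_instance)
  factor p q hpq := by
    by_cases hp : IsSplitMono p
    · exact Or.inr hp
    obtain ⟨k, rfl⟩ := hf.almostSplit.factor p hp
    have := hf.minimal (k ≫ q) (by rw [← Category.assoc, hpq])
    exact Or.inl (IsSplitEpi.mk' ⟨inv (k ≫ q) ≫ k, by simp⟩)

theorem IsMinRightAlmostSplit.isIrreducibleMor {Y Z : C} {g : Y ⟶ Z} [Epi g]
    (hg : IsMinRightAlmostSplit g) : IsIrreducibleMor g where
  not_section h := hg.almostSplit.not_retraction (by
    have := isIso_of_epi_of_isSplitMono g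
    infer_instance)
  not_retraction := hg.almostSplit.not_retraction
  factor p q hpq := by
    by_cases hq : IsSplitEpi q
    · exact Or.inl hq
    obtain ⟨k, rfl⟩ := hg.almostSplit.factor q hq
    have := hg.minimal (p ≫ k) (by rw [Category.assoc, hpq])
    exact Or.inr (IsSplitMono.mk' ⟨k ≫ inv (p ≫ k), by
      rw [← Category.assoc, IsIso.hom_inv_id]⟩)

end Category

section Preadditive

variable {C : Type u} [Category.{v} C] [Preadditive C]

/-! ### Local endomorphism rings -/

theorem isIso_or_isIso_of_add_eq_id {X : C} (hX : IsLocalRing (End X)) {a b : X ⟶ X}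
    (h : a + b = 𝟙 X) : IsIso a ∨ IsIso b := by
  simpa only [isUnit_iff_isIso] using
    IsLocalRing.isUnit_or_isUnit_of_add_one (R := End X) (a := a) (b := b) h

theorem isLocalRing_end_of_isIso_or_isIso {X : C} (h0 : ¬ IsZero X)
    (h : ∀ a b : X ⟶ X, a + b = 𝟙 X → IsIso a ∨ IsIso b) : IsLocalRing (End X) where
  exists_pair_ne := ⟨𝟙 X, 0, fun e => h0 ((IsZero.iff_id_eq_zero X).2 e)⟩
  isUnit_or_isUnit_of_add_one {a b} hab := by
    simpa only [isUnit_iff_isIso] using h a b hab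

theorem isLocalRing_end_of_iso {X Y : C} (e : X ≅ Y) (hX : IsLocalRing (End X)) :
    IsLocalRing (End Y) := by
  refine isLocalRing_end_of_isIso_or_isIso (fun h => ?_) fun a b hab => ?_
  · exact one_ne_zero (α := End X) ((h.of_iso e).eq_of_src _ _)
  · have key : ∀ c : Y ⟶ Y, IsIso (e.hom ≫ c ≫ e.inv) → IsIso c := fun c hc => by
      have : c = e.inv ≫ (e.hom ≫ c ≫ e.inv) ≫ e.hom := by simp
      rw [this]
      infer_instance
    refine (isIso_or_isIso_of_add_eq_id hX (a := e.hom ≫ a ≫ e.inv)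
      (b := e.hom ≫ b ≫ e.inv) ?_).imp (key a) (key b)
    rw [← Preadditive.comp_add, ← Preadditive.add_comp, hab]
    simp

/-- A local endomorphism ring has no idempotents besides `0` and `1`, so an object with such a ring
has no nonzero proper summands. -/
theorem isIso_of_retract_of_isLocalRing {U Y : C} (hU : IsLocalRing (End U)) (hY : ¬ IsZero Y)
    {s : Y ⟶ U} {r : U ⟶ Y} (h : s ≫ r = 𝟙 Y) : IsIso s := by
  have hs : s ≫ (𝟙 U - r ≫ s) = 0 := by simp [reassoc_of% h]
  rcases isIso_or_isIso_of_add_eq_id hU (add_sub_cancel (r ≫ s) (𝟙 U)) with hi | hi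
  · have : IsSplitEpi s := IsSplitEpi.mk' ⟨inv (r ≫ s) ≫ r, by simp⟩
    have : IsSplitMono s := IsSplitMono.mk' ⟨r, h⟩
    exact isIso_of_mono_of_isSplitEpi s
  · have : s = 0 := by rw [← cancel_mono (𝟙 U - r ≫ s), hs, zero_comp]
    exact absurd ((IsZero.iff_id_eq_zero Y).2 (by rw [← h, this, zero_comp])) hY

/-- The inverse of `1 + v ≫ u` is `1 - v ≫ (1 + u ≫ v)⁻¹ ≫ u`. -/
theorem isIso_id_add_comp_swap {A B : C} (u : A ⟶ B) (v : B ⟶ A) (h : IsIso (𝟙 A + u ≫ v)) :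
    IsIso (𝟙 B + v ≫ u) := by
  obtain ⟨w, hw₁, hw₂⟩ := h
  have h₁ : u ≫ v ≫ w = 𝟙 A - w := by
    rw [eq_sub_iff_add_eq', ← hw₁]
    simp
  have h₂ : w ≫ u ≫ v = 𝟙 A - w := by
    rw [eq_sub_iff_add_eq', ← hw₂]
    simp
  refine ⟨𝟙 B - v ≫ w ≫ u, ?_, ?_⟩
  · have := congrArg (fun t => v ≫ t ≫ u) h₁
    simp only [Category.assoc, Preadditive.sub_comp, Preadditive.comp_sub, Category.id_comp]
      at this
    simp only [Preadditive.add_comp, Preadditive.comp_sub, Category.comp_id, Category.id_comp,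
      Category.assoc, this]
    abel
  · have := congrArg (fun t => v ≫ t ≫ u) h₂
    simp only [Category.assoc, Preadditive.sub_comp, Preadditive.comp_sub, Category.id_comp]
      at this
    simp only [Preadditive.sub_comp, Preadditive.comp_add, Category.comp_id, Category.id_comp,
      Category.assoc, this]
    abel

/-! ### Almost split morphisms and local endomorphism rings -/

theorem IsLeftAlmostSplit.isLocalRing_end {X Y : C} {f : X ⟶ Y} (hf : IsLeftAlmostSplit f) :
    IsLocalRing (End X) := by
  have h0 : ¬ IsZero X := fun h => hf.not_section (IsSplitMono.mk' ⟨0, h.eq_of_src _ _⟩)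
  have sec : ∀ a b : X ⟶ X, a + b = 𝟙 X → IsSplitMono a ∨ IsSplitMono b := fun a b hab => by
    by_contra! hn
    obtain ⟨k, rfl⟩ := hf.factor a hn.1
    obtain ⟨l, rfl⟩ := hf.factor b hn.2
    exact hf.not_section (IsSplitMono.mk' ⟨k + l, by rw [Preadditive.comp_add, hab]⟩)
  -- A section `a` with retraction `r` splits off the idempotent `r ≫ a`. Of `r ≫ a` and `1 - r ≫ a`
  -- one is a section, hence equal to `1`. In the second case `a = 0`, contradicting `h0`.
  have iso : ∀ a : X ⟶ X, IsSplitMono a → IsIso a := fun a ha => by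
    have hr : a ≫ retraction a = 𝟙 X := IsSplitMono.id a
    rcases sec _ _ (add_sub_cancel (retraction a ≫ a) (𝟙 X)) with h | h
    · refine ⟨retraction a, hr, ?_⟩
      rw [← cancel_mono (retraction a ≫ a)]
      simp
    · have : retraction a ≫ a = 0 := by
        rw [← cancel_mono (𝟙 X - retraction a ≫ a)]
        simp
      refine absurd ((IsZero.iff_id_eq_zero X).2 ?_) h0
      calc 𝟙 X = a ≫ (retraction a ≫ a) ≫ retraction a := by simp
        _ = 0 := by rw [this, zero_comp, comp_zero]
  exact isLocalRing_end_of_isIso_or_isIso h0 fun a b hab => (sec a b hab).imp (iso a) (iso b)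

theorem IsRightAlmostSplit.isLocalRing_end {Y Z : C} {g : Y ⟶ Z} (hg : IsRightAlmostSplit g) :
    IsLocalRing (End Z) := by
  have h0 : ¬ IsZero Z := fun h => hg.not_retraction (IsSplitEpi.mk' ⟨0, h.eq_of_src _ _⟩)
  have ret : ∀ a b : Z ⟶ Z, a + b = 𝟙 Z → IsSplitEpi a ∨ IsSplitEpi b := fun a b hab => by
    by_contra! hn
    obtain ⟨k, rfl⟩ := hg.factor a hn.1
    obtain ⟨l, rfl⟩ := hg.factor b hn.2
    exact hg.not_retraction (IsSplitEpi.mk' ⟨k + l, by rw [Preadditive.add_comp, hab]⟩)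
  have iso : ∀ a : Z ⟶ Z, IsSplitEpi a → IsIso a := fun a ha => by
    have hs : section_ a ≫ a = 𝟙 Z := IsSplitEpi.id a
    rcases ret _ _ (add_sub_cancel (a ≫ section_ a) (𝟙 Z)) with h | h
    · refine ⟨section_ a, ?_, hs⟩
      rw [← cancel_epi (a ≫ section_ a)]
      simp
    · have : a ≫ section_ a = 0 := by
        rw [← cancel_epi (𝟙 Z - a ≫ section_ a)]
        simp
      refine absurd ((IsZero.iff_id_eq_zero Z).2 ?_) h0
      calc 𝟙 Z = section_ a ≫ (a ≫ section_ a) ≫ a := by simp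
        _ = 0 := by rw [this, zero_comp, comp_zero]
  exact isLocalRing_end_of_isIso_or_isIso h0 fun a b hab => (ret a b hab).imp (iso a) (iso b)

/-! ### Short exact sequences -/

namespace IsShortExact

variable {X Y Z : C} {f : X ⟶ Y} {g : Y ⟶ Z}

theorem mono (h : IsShortExact f g) : Mono f :=
  ⟨fun _ _ e => Fork.IsLimit.hom_ext h.isKernel.some e⟩

theorem epi (h : IsShortExact f g) : Epi g :=
  ⟨fun _ _ e => Cofork.IsColimit.hom_ext h.isCokernel.some e⟩

theorem isWeakKernel (h : IsShortExact f g) : IsWeakKernel f g where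
  zero := h.zero
  factor k hk :=
    let l := KernelFork.IsLimit.lift' h.isKernel.some k hk
    ⟨l.1, l.2⟩

theorem isWeakCokernel (h : IsShortExact f g) : IsWeakCokernel f g where
  zero := h.zero
  factor k hk :=
    let l := CokernelCofork.IsColimit.desc' h.isCokernel.some k hk
    ⟨l.1, l.2⟩

theorem isSplitMono_iff_isSplitEpi (h : IsShortExact f g) : IsSplitMono f ↔ IsSplitEpi g := by
  have := h.mono
  have := h.epi
  constructor
  · intro hf
    obtain ⟨s, hs⟩ := h.isWeakCokernel.factor (𝟙 Y - retraction f ≫ f) (by simp)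
    refine IsSplitEpi.mk' ⟨s, ?_⟩
    rw [← cancel_epi g, reassoc_of% hs]
    simp [h.zero]
  · intro hg
    obtain ⟨r, hr⟩ := h.isWeakKernel.factor (𝟙 Y - g ≫ section_ g) (by simp)
    refine IsSplitMono.mk' ⟨r, ?_⟩
    rw [← cancel_mono f, Category.assoc, hr]
    simp [reassoc_of% h.zero]

theorem isLeftMinimal (h : IsShortExact f g) (hZ : IsLocalRing (End Z)) (hg : ¬ IsSplitEpi g) :
    IsLeftMinimal f := by
  intro e he
  obtain ⟨k, hk⟩ := h.isWeakCokernel.factor (e - 𝟙 Y) (by simp [he])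
  obtain rfl : e = 𝟙 Y + g ≫ k := by rw [hk, add_sub_cancel]
  refine isIso_id_add_comp_swap k g ?_
  refine (isIso_or_isIso_of_add_eq_id hZ (a := 𝟙 Z + k ≫ g) (b := -(k ≫ g))
    (add_neg_cancel_right _ _)).resolve_right fun hi => hg ?_
  exact IsSplitEpi.mk' ⟨inv (-(k ≫ g)) ≫ (-k), by
    rw [Category.assoc, Preadditive.neg_comp, IsIso.inv_hom_id]⟩

theorem isRightMinimal (h : IsShortExact f g) (hX : IsLocalRing (End X)) (hf : ¬ IsSplitMono f) :
    IsRightMinimal g := by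
  intro e he
  obtain ⟨k, hk⟩ := h.isWeakKernel.factor (e - 𝟙 Y) (by simp [he])
  obtain rfl : e = 𝟙 Y + k ≫ f := by rw [hk, add_sub_cancel]
  refine isIso_id_add_comp_swap f k ?_
  refine (isIso_or_isIso_of_add_eq_id hX (a := 𝟙 X + f ≫ k) (b := -(f ≫ k))
    (add_neg_cancel_right _ _)).resolve_right fun hi => hf ?_
  exact IsSplitMono.mk' ⟨(-k) ≫ inv (-(f ≫ k)), by
    rw [← Category.assoc, Preadditive.comp_neg, IsIso.hom_inv_id]⟩

theorem isAuslanderReitenSeq (h : IsShortExact f g) (hf : IsLeftAlmostSplit f)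
    (hg : IsRightAlmostSplit g) : IsAuslanderReitenSeq f g where
  weakKernel := h.isWeakKernel
  weakCokernel := h.isWeakCokernel
  left := ⟨h.isLeftMinimal hg.isLocalRing_end hg.not_retraction, hf⟩
  right := ⟨h.isRightMinimal hf.isLocalRing_end hf.not_section, hg⟩

end IsShortExact

/-! ### Stable exact sequences -/

namespace IsStableExact

variable [IsPreabelian C] {X Y Z : C} {f : X ⟶ Y} {g : Y ⟶ Z}

theorem exists_pullback (h : IsStableExact f g) {Z' : C} (b : Z' ⟶ Z) :
    ∃ (Y' : C) (f' : X ⟶ Y') (g' : Y' ⟶ Z') (b' : Y' ⟶ Y),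
      IsShortExact f' g' ∧ f' ≫ b' = f ∧ b' ≫ g = g' ≫ b := by
  have : HasEqualizers C := Preadditive.hasEqualizers_of_hasKernels
  have : HasPullbacks C := hasPullbacks_of_hasBinaryProducts_of_hasEqualizers C
  have hp := IsPullback.of_hasPullback g b
  have w : f ≫ g = (0 : X ⟶ Z') ≫ b := by rw [h.shortExact.zero, zero_comp]
  exact ⟨_, hp.lift f 0 w, pullback.snd g b, pullback.fst g b,
    h.pullback b _ _ _ hp (hp.lift_snd _ _ _) (hp.lift_fst _ _ _), hp.lift_fst _ _ _, hp.w⟩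

theorem exists_pushout (h : IsStableExact f g) {X' : C} (a : X ⟶ X') :
    ∃ (Y' : C) (f' : X' ⟶ Y') (g' : Y' ⟶ Z) (a' : Y ⟶ Y'),
      IsShortExact f' g' ∧ a' ≫ g' = g ∧ f ≫ a' = a ≫ f' := by
  have : HasCoequalizers C := Preadditive.hasCoequalizers_of_hasCokernels
  have : HasPushouts C := hasPushouts_of_hasBinaryCoproducts_of_hasCoequalizers C
  have hp := IsPushout.of_hasPushout f a
  have w : f ≫ g = a ≫ (0 : X' ⟶ Z) := by rw [h.shortExact.zero, comp_zero]
  exact ⟨_, pushout.inr f a, hp.desc g 0 w, pushout.inl f a,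
    h.pushout a _ _ _ hp (hp.inr_desc _ _ _) (hp.inl_desc _ _ _), hp.inl_desc _ _ _, hp.w⟩

theorem isLeftAlmostSplit (h : IsStableExact f g) (hX : IsLocalRing (End X))
    (hg : IsRightAlmostSplit g) : IsLeftAlmostSplit f := by
  have hf : ¬ IsSplitMono f := fun hf =>
    hg.not_retraction (h.shortExact.isSplitMono_iff_isSplitEpi.1 hf)
  refine ⟨hf, fun {X'} a ha => ?_⟩
  obtain ⟨Y', f', g', a', h', hg', w⟩ := h.exists_pushout a
  by_cases hs : IsSplitEpi g'
  · have := h'.isSplitMono_iff_isSplitEpi.2 hs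
    exact ⟨a' ≫ retraction f', by simp [reassoc_of% w]⟩
  exfalso
  obtain ⟨k, hk⟩ := hg.factor g' hs
  obtain ⟨c, hc⟩ := h.shortExact.isWeakKernel.factor (f' ≫ k) (by rw [Category.assoc, hk, h'.zero])
  obtain ⟨m, hm⟩ := h.shortExact.isWeakKernel.factor (𝟙 Y - a' ≫ k) (by simp [hk, hg'])
  have hfm : f ≫ m = 𝟙 X - a ≫ c := by
    have := h.shortExact.mono
    rw [← cancel_mono f, Category.assoc, hm]
    simp [reassoc_of% w, hc]
  rcases isIso_or_isIso_of_add_eq_id hX (add_sub_cancel (a ≫ c) (𝟙 X)) with hi | hi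
  · exact ha (IsSplitMono.mk' ⟨c ≫ inv (a ≫ c), by rw [← Category.assoc, IsIso.hom_inv_id]⟩)
  · exact hf (IsSplitMono.mk' ⟨m ≫ inv (𝟙 X - a ≫ c), by
      rw [← Category.assoc, hfm, IsIso.hom_inv_id]⟩)

theorem isRightAlmostSplit (h : IsStableExact f g) (hZ : IsLocalRing (End Z))
    (hf : IsLeftAlmostSplit f) : IsRightAlmostSplit g := by
  have hg : ¬ IsSplitEpi g := fun hg =>
    hf.not_section (h.shortExact.isSplitMono_iff_isSplitEpi.2 hg)
  refine ⟨hg, fun {Z'} b hb => ?_⟩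
  obtain ⟨Y', f', g', b', h', hf', w⟩ := h.exists_pullback b
  by_cases hs : IsSplitMono f'
  · have := h'.isSplitMono_iff_isSplitEpi.1 hs
    exact ⟨section_ g' ≫ b', by simp [w]⟩
  exfalso
  obtain ⟨k, hk⟩ := hf.factor f' hs
  obtain ⟨c, hc⟩ := h.shortExact.isWeakCokernel.factor (k ≫ g')
    (by rw [← Category.assoc, hk, h'.zero])
  obtain ⟨m, hm⟩ := h.shortExact.isWeakCokernel.factor (𝟙 Y - k ≫ b') (by
    simp [reassoc_of% hk, hf'])
  have hmg : m ≫ g = 𝟙 Z - c ≫ b := by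
    have := h.shortExact.epi
    rw [← cancel_epi g, ← Category.assoc, hm]
    simp [w, reassoc_of% hc]
  rcases isIso_or_isIso_of_add_eq_id hZ (add_sub_cancel (c ≫ b) (𝟙 Z)) with hi | hi
  · exact hb (IsSplitEpi.mk' ⟨inv (c ≫ b) ≫ c, by simp⟩)
  · exact hg (IsSplitEpi.mk' ⟨inv (𝟙 Z - c ≫ b) ≫ m, by
      rw [Category.assoc, hmg, IsIso.inv_hom_id]⟩)

end IsStableExact

/-! ### Krull-Schmidt categories -/

theorem IsKrullSchmidt.exists_decomposition (hC : IsKrullSchmidt C) (X : C) :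
    ∃ (n : ℕ) (M : Fin n → C) (i : ∀ j, M j ⟶ X) (p : ∀ j, X ⟶ M j),
      (∀ j, IsLocalRing (End (M j))) ∧ (∀ j, i j ≫ p j = 𝟙 (M j)) ∧ ∑ j, p j ≫ i j = 𝟙 X := by
  have := hC.hasFiniteBiproducts
  obtain ⟨n, M, hM, ⟨e⟩⟩ := hC.decomposition X
  refine ⟨n, M, fun j => biproduct.ι M j ≫ e.inv, fun j => e.hom ≫ biproduct.π M j, hM,
    fun j => by simp, ?_⟩
  have : ∑ j, (e.hom ≫ biproduct.π M j) ≫ biproduct.ι M j ≫ e.inv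
      = e.hom ≫ (∑ j, biproduct.π M j ≫ biproduct.ι M j) ≫ e.inv := by
    rw [Preadditive.sum_comp, Preadditive.comp_sum]
    simp only [Category.assoc]
  rw [this, biproduct.total]
  simp

/-- A morphism lifts through `g` if its restrictions to indecomposable summands of its source do. -/
theorem IsKrullSchmidt.exists_lift (hC : IsKrullSchmidt C) {U Y Z : C} (g : Y ⟶ Z) (b : U ⟶ Z)
    (h : ∀ (M : C) (i : M ⟶ U), IsLocalRing (End M) → IsSplitMono i → ∃ k, k ≫ g = i ≫ b) :
    ∃ k, k ≫ g = b := by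
  obtain ⟨n, M, i, p, hM, hip, hsum⟩ := hC.exists_decomposition U
  choose k hk using fun j => h (M j) (i j) (hM j) (IsSplitMono.mk' ⟨p j, hip j⟩)
  refine ⟨∑ j, p j ≫ k j, ?_⟩
  simp_rw [Preadditive.sum_comp, Category.assoc, hk, ← Category.assoc]
  rw [← Preadditive.sum_comp, hsum, Category.id_comp]

theorem IsKrullSchmidt.exists_extension (hC : IsKrullSchmidt C) {X Y U : C} (f : X ⟶ Y)
    (a : X ⟶ U)
    (h : ∀ (M : C) (p : U ⟶ M), IsLocalRing (End M) → IsSplitEpi p → ∃ k, f ≫ k = a ≫ p) :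
    ∃ k, f ≫ k = a := by
  obtain ⟨n, M, i, p, hM, hip, hsum⟩ := hC.exists_decomposition U
  choose k hk using fun j => h (M j) (p j) (hM j) (IsSplitEpi.mk' ⟨i j, hip j⟩)
  refine ⟨∑ j, k j ≫ i j, ?_⟩
  simp_rw [Preadditive.comp_sum, ← Category.assoc, hk, Category.assoc]
  rw [← Preadditive.comp_sum, hsum, Category.comp_id]

variable [IsPreabelian C] {X Y Z : C} {f : X ⟶ Y} {g : Y ⟶ Z}

theorem IsMinLeftAlmostSplit.isLocalRing_end_coker (hC : IsKrullSchmidt C)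
    (h : IsStableExact f g) (hf : IsMinLeftAlmostSplit f) : IsLocalRing (End Z) := by
  by_contra hZ
  have hg : ¬ IsSplitEpi g := fun hg =>
    hf.almostSplit.not_section (h.shortExact.isSplitMono_iff_isSplitEpi.2 hg)
  obtain ⟨s, hs⟩ := hC.exists_lift g (𝟙 Z) fun Z' b hZ' hb => by
    obtain ⟨Y', f', g', b', h', hf', w⟩ := h.exists_pullback b
    by_cases hs : IsSplitMono f'
    · have := h'.isSplitMono_iff_isSplitEpi.1 hs
      exact ⟨section_ g' ≫ b', by simp [w]⟩
    obtain ⟨k, hk⟩ := hf.almostSplit.factor f' hs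
    have := hf.minimal (k ≫ b') (by rw [reassoc_of% hk, hf'])
    have : IsSplitEpi b' := IsSplitEpi.mk' ⟨inv (k ≫ b') ≫ k, by simp⟩
    have := h.shortExact.epi
    have : Epi (g' ≫ b) := w ▸ epi_comp b' g
    have : Epi b := epi_of_epi g' b
    have := isIso_of_epi_of_isSplitMono b
    exact absurd (isLocalRing_end_of_iso (asIso b) hZ') hZ
  exact hg (IsSplitEpi.mk' ⟨s, hs⟩)

theorem IsMinRightAlmostSplit.isLocalRing_end_ker (hC : IsKrullSchmidt C)
    (h : IsStableExact f g) (hg : IsMinRightAlmostSplit g) : IsLocalRing (End X) := by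
  by_contra hX
  have hf : ¬ IsSplitMono f := fun hf =>
    hg.almostSplit.not_retraction (h.shortExact.isSplitMono_iff_isSplitEpi.1 hf)
  obtain ⟨r, hr⟩ := hC.exists_extension f (𝟙 X) fun X' a hX' ha => by
    obtain ⟨Y', f', g', a', h', hg', w⟩ := h.exists_pushout a
    by_cases hs : IsSplitEpi g'
    · have := h'.isSplitMono_iff_isSplitEpi.2 hs
      exact ⟨a' ≫ retraction f', by simp [reassoc_of% w]⟩
    obtain ⟨k, hk⟩ := hg.almostSplit.factor g' hs
    have := hg.minimal (a' ≫ k) (by rw [Category.assoc, hk, hg'])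
    have : IsSplitMono a' := IsSplitMono.mk' ⟨k ≫ inv (a' ≫ k), by
      rw [← Category.assoc, IsIso.hom_inv_id]⟩
    have := h.shortExact.mono
    have : Mono (a ≫ f') := w ▸ mono_comp f a'
    have : Mono a := mono_of_mono a f'
    have := isIso_of_mono_of_isSplitEpi a
    exact absurd (isLocalRing_end_of_iso (asIso a).symm hX') hX
  exact hf (IsSplitMono.mk' ⟨r, hr⟩)

theorem IsStableExact.isRightAlmostSplit_of_irreducible (hC : IsKrullSchmidt C)
    (h : IsStableExact f g) (hf : IsIrreducibleMor f) (hg : IsIrreducibleMor g) :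
    IsRightAlmostSplit g := by
  have := h.shortExact.epi
  refine ⟨hg.not_retraction, fun {U} b₀ hb₀ => hC.exists_lift g b₀ fun M i hM _ => ?_⟩
  have hb : ¬ IsSplitEpi (i ≫ b₀) := fun _ => hb₀ (IsSplitEpi.mk' ⟨section_ (i ≫ b₀) ≫ i, by simp⟩)
  generalize i ≫ b₀ = b at hb ⊢
  obtain ⟨Y', f', g', b', h', hf', w⟩ := h.exists_pullback b
  rcases hf.factor f' b' hf' with hs | hs
  · -- Here `g` factors through `b`, so `Y` is a nonzero summand of `M`.
    have hgb : (section_ b' ≫ g') ≫ b = g := by simp [← w]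
    have hu := (hg.factor _ _ hgb).resolve_left hb
    have hY : ¬ IsZero Y := fun hY => hg.not_retraction (by
      refine IsSplitEpi.mk' ⟨0, ?_⟩
      rw [← cancel_epi g]
      exact hY.eq_of_src _ _)
    have := isIso_of_retract_of_isLocalRing hM hY (IsSplitMono.id (section_ b' ≫ g'))
    exact ⟨inv (section_ b' ≫ g'), by rw [IsIso.inv_comp_eq, hgb]⟩
  · have := h'.isSplitMono_iff_isSplitEpi.1 hs
    exact ⟨section_ g' ≫ b', by simp [w]⟩

theorem IsStableExact.isLeftAlmostSplit_of_irreducible (hC : IsKrullSchmidt C)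
    (h : IsStableExact f g) (hf : IsIrreducibleMor f) (hg : IsIrreducibleMor g) :
    IsLeftAlmostSplit f := by
  have := h.shortExact.mono
  refine ⟨hf.not_section, fun {U} a₀ ha₀ => hC.exists_extension f a₀ fun M p hM _ => ?_⟩
  have ha : ¬ IsSplitMono (a₀ ≫ p) := fun _ =>
    ha₀ (IsSplitMono.mk' ⟨p ≫ retraction (a₀ ≫ p), by
      rw [← Category.assoc, IsSplitMono.id]⟩)
  generalize a₀ ≫ p = a at ha ⊢
  obtain ⟨Y', f', g', a', h', hg', w⟩ := h.exists_pushout a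
  rcases hg.factor a' g' hg' with hs | hs
  · have := h'.isSplitMono_iff_isSplitEpi.2 hs
    exact ⟨a' ≫ retraction f', by simp [reassoc_of% w]⟩
  · have hfa : a ≫ f' ≫ retraction a' = f := by simp [← reassoc_of% w]
    have hu := (hf.factor _ _ hfa).resolve_right ha
    have hY : ¬ IsZero Y := fun hY => hf.not_section (by
      refine IsSplitMono.mk' ⟨0, ?_⟩
      rw [← cancel_mono f]
      exact hY.eq_of_tgt _ _)
    have hi := isIso_of_retract_of_isLocalRing hM hY (IsSplitEpi.id (f' ≫ retraction a'))
    -- The chosen section of the retraction `M ⟶ Y` is invertible, so it is a two-sided inverse.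
    refine ⟨section_ (f' ≫ retraction a'), ?_⟩
    have hq : (f' ≫ retraction a') ≫ section_ (f' ≫ retraction a') = 𝟙 M := by
      rw [← cancel_epi (section_ (f' ≫ retraction a'))]
      simp only [IsSplitEpi.id_assoc, Category.comp_id]
    rw [← Category.comp_id a, ← hq, ← Category.assoc, hfa]

end Preadditive

end AuslanderReiten

open AuslanderReiten in
theorem mainTheorem1 {C : Type u} [Category.{v} C] [Preadditive C]
    [AuslanderReiten.IsPreabelian C] [EssentiallySmall.{v} C]
    {X Y Z : C} (f : X ⟶ Y) (g : Y ⟶ Z) (hξ : AuslanderReiten.IsStableExact f g) :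
    List.TFAE
      [AuslanderReiten.IsAuslanderReitenSeq f g,
       IsLocalRing (End X) ∧ AuslanderReiten.IsRightAlmostSplit g,
       IsLocalRing (End Z) ∧ AuslanderReiten.IsLeftAlmostSplit f] ∧
    (AuslanderReiten.IsQuasiAbelian C → AuslanderReiten.IsKrullSchmidt C →
      List.TFAE
        [AuslanderReiten.IsAuslanderReitenSeq f g,
         IsLocalRing (End X) ∧ AuslanderReiten.IsRightAlmostSplit g,
         IsLocalRing (End Z) ∧ AuslanderReiten.IsLeftAlmostSplit f,
         AuslanderReiten.IsMinLeftAlmostSplit f,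
         AuslanderReiten.IsMinRightAlmostSplit g,
         AuslanderReiten.IsIrreducibleMor f ∧ AuslanderReiten.IsIrreducibleMor g]) := by
  have h12 : IsAuslanderReitenSeq f g → IsLocalRing (End X) ∧ IsRightAlmostSplit g := fun h =>
    ⟨h.left.almostSplit.isLocalRing_end, h.right.almostSplit⟩
  have h13 : IsAuslanderReitenSeq f g → IsLocalRing (End Z) ∧ IsLeftAlmostSplit f := fun h =>
    ⟨h.right.almostSplit.isLocalRing_end, h.left.almostSplit⟩
  have h21 : IsLocalRing (End X) ∧ IsRightAlmostSplit g → IsAuslanderReitenSeq f g := fun h =>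
    hξ.shortExact.isAuslanderReitenSeq (hξ.isLeftAlmostSplit h.1 h.2) h.2
  have h31 : IsLocalRing (End Z) ∧ IsLeftAlmostSplit f → IsAuslanderReitenSeq f g := fun h =>
    hξ.shortExact.isAuslanderReitenSeq h.2 (hξ.isRightAlmostSplit h.1 h.2)
  refine ⟨?_, fun _ hC => ?_⟩
  · tfae_have 1 → 2 := h12
    tfae_have 2 → 1 := h21
    tfae_have 1 → 3 := h13
    tfae_have 3 → 1 := h31
    tfae_finish
  · have := hξ.shortExact.mono
    have := hξ.shortExact.epi
    tfae_have 1 → 2 := h12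
    tfae_have 2 → 1 := h21
    tfae_have 1 → 3 := h13
    tfae_have 3 → 1 := h31
    tfae_have 1 → 4 := fun h => h.left
    tfae_have 4 → 3 := fun h => ⟨h.isLocalRing_end_coker hC hξ, h.almostSplit⟩
    tfae_have 1 → 5 := fun h => h.right
    tfae_have 5 → 2 := fun h => ⟨h.isLocalRing_end_ker hC hξ, h.almostSplit⟩
    tfae_have 1 → 6 := fun h => ⟨h.left.isIrreducibleMor, h.right.isIrreducibleMor⟩
    tfae_have 6 → 1 := fun h => hξ.shortExact.isAuslanderReitenSeq
      (hξ.isLeftAlmostSplit_of_irreducible hC h.1 h.2)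
      (hξ.isRightAlmostSplit_of_irreducible hC h.1 h.2)
    tfae_finish
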